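/- **Setting.** Let $q_j=\sum_{a=1}^{L}a_{ja}k_a+r_j$, $r_j=\sum_{i=1}^{n}b_{ji}p_i$ $(1\le j\le p)$, with $a_{ja},b_{ji}\in\{-1,0,1\}$, be the momenta of $p$ propagators. Here $k_1,\dots,k_L$ are the loop momenta, which are independent (the $p\times L$ matrix $(a_{ja})$ has rank $L$), and $p_1,\dots,p_n$ are real Minkowski vectors (signature $(+,-,\dots,-)$), the independent external momenta ($n=E-1$). Put $A(\alpha)_{ab}=\sum_j\alpha_ja_{ja}a_{jb}$, $v_a=\sum_j\alpha_ja_{ja}r_j$ and $$\mathcal U(\alpha)=\det A(\alpha),\qquad \widetilde{\mathcal F}(\alpha)=\sum_{a,b}\operatorname{adj}(A)_{ab}\,v_a\cdot v_b-\mathcal U\sum_j\alpha_j r_j^2,\qquad \mathcal F(\alpha;x)=\mathcal U(\alpha)\sum_j m_j^2\alpha_j+\widetilde{\mathcal F}(\alpha),$$ where $x=((p_i\cdot p_k)_{i,k},m_1^2,\dots,m_p^2)$ are the external scales. **The Feynman integral.** For $\nu\in\mathbb C^p$, $D\in\mathbb C$, complex squared masses and $\theta\in[0,\pi/2]$ let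 $$S_\theta(x;\nu;D)=e^{i\theta(\sum_j\nu_j-LD/2)}\int_{(0,\infty)^p}\prod_{j=1}^p\frac{\alpha_j^{\nu_j-1}d\alpha_j}{\Gamma(\nu_j)}\;\mathcal U(\alpha)^{-D/2}\exp\!\big(-e^{i\theta}\mathcal F(\alpha;x)/\mathcal U(\alpha)\big)$$ be the Schwinger integral along the ray $e^{i\theta}\mathbb R_+$ ($\theta=0$ is the usual one). It is used for those masses for which $\operatorname{Re}(e^{i\theta}\mathcal F/\mathcal U)\ge c\sum_j\alpha_j$ on $(0,\infty)^p$ for some $c>0$. Let $\mathcal M$ be the set of all $(m_j^2)_j\in\mathbb C^p$ with this property for some $\theta\in[0,\pi/2]$; it contains all masses with $\operatorname{Im}m_j^2<0$ for all $j$. Let $S(x;\nu;D)$ be the continuation of these integrals from large $\operatorname{Re}\nu_j$ and $-\operatorname{Re}D$: a quotient $N/h$ on a region $\{\operatorname{Re}\nu_j>b_j,\ \operatorname{Re}D<c\}$, where $N$ is analytic in $(m^2,\nu,D)$ for $m^2\in\mathcal M$ and $h$ is analytic in $(\nu,D)$. We call $(\nu,D)$ *regular* if some such continuation exists around it with $h(\nu,D)\ne0$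 (the dimensionally regularised integral is finite there). For $\nu\in\mathbb Z^p$ and $D=D_0-2\epsilon$ with $D_0\in\mathbb Z$, $\epsilon\in\mathbb C$, put $$I(x;\nu;D)=e^{\gamma_EL\epsilon}S(x;\nu;D)\quad (m^2\in\mathcal M),\qquad I(x;\nu;D)=\lim_{\eta\to0^+}I(x;\nu;D)\big|_{m_j^2\to m_j^2-i\eta}\quad(\text{real squared masses}).$$ The shift $D\to D-2$ means $D_0\to D_0-2$ with $\epsilon$ fixed. Real squared masses $m^2$ are *generic* (for $\nu$, $D$) if they are not a singular point of $I$: the holomorphic function $I(\cdot;\nu;D)$ on $\{\operatorname{Im}m_j^2<0\ \forall j\}$ continues analytically to a neighbourhood of $m^2$. **Proposition.** Let $\nu\in\mathbb Z^p$ and $D=D_0-2\epsilon$ be such that $(\nu,D)$ is regular. Then: 1. $(\nu,D-2)$ is regular. 2. All positive squared masses in $\mathcal M$ are generic. 3. If the squared masses are positive and generic, then the limits defining $I(\cdot;\nu;D)$ and $I(\cdot;\nu;D-2)$ exist for all real squared masses near $m^2$, both functions are real analytic at $m^2$, and $$I(x;\nu;D-2)=(-1)^L\,\mathcal U\!\left(\frac{\partial}{\partial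 m_1^2},\dots,\frac{\partial}{\partial m_p^2}\right)I(x;\nu;D),$$ where the derivatives are taken in $m_1^2,\dots,m_p^2$ as independent variables, at fixed external momenta. -/

import Mathlib

open Filter Topology MeasureTheory
open scoped BigOperators

noncomputable section

namespace Feynman

/-- Minkowski product of signature `(+,-,…,-)` on `ℝ^{1+d}`. -/
def minkowski {d : ℕ} (v w : Fin (d + 1) → ℝ) : ℝ :=
  v 0 * w 0 - ∑ i : Fin d, v i.succ * w i.succ

/-- The external scales `s i k = p_i · p_k` of the independent external momenta. -/
def scales {d n : ℕ} (P : Fin n → Fin (d + 1) → ℝ) : Matrix (Fin n) (Fin n) ℝ :=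
  fun i k => minkowski (P i) (P k)

/-- Momentum routing of a family of Feynman integrals with `p` propagators, `L` loop momenta `k_a`
and `n = E - 1` independent external momenta `p_i` (the last external momentum is `-∑ p_i`).
The momentum through the propagator `j` is `q_j = ∑ a, loop j a • k_a + ∑ i, ext j i • p_i`,
with coefficients in `{-1, 0, 1}`; the `L` loop momenta are independent. -/
structure Family (p L n : ℕ) where
  loop : Fin p → Fin L → SignType
  ext : Fin p → Fin n → SignType
  loop_indep : LinearIndependent ℝ (fun (a : Fin L) (j : Fin p) => ((loop j a : SignType) : ℝ))

namespace Family

variable {p L n : ℕ} (Γ : Family p L n)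

/-- The `L × L` matrix `A(α)` of the quadratic form `∑ j, α_j q_j²` in the loop momenta. -/
def loopMatrix : Matrix (Fin L) (Fin L) (MvPolynomial (Fin p) ℝ) :=
  fun a b => ∑ j, MvPolynomial.C ((Γ.loop j a : ℝ) * (Γ.loop j b : ℝ)) * MvPolynomial.X j

/-- The first Symanzik polynomial `𝒰(α) = det A(α)`. -/
def symanzikU : MvPolynomial (Fin p) ℝ := Γ.loopMatrix.det

/-- The product `r_j · r_l`, where `r_j = ∑ i, ext j i • p_i` is the external part of `q_j`. -/
def extProd (s : Matrix (Fin n) (Fin n) ℝ) (j l : Fin p) : ℝ :=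
  ∑ i, ∑ k, (Γ.ext j i : ℝ) * (Γ.ext l k : ℝ) * s i k

/-- The product `v_a · v_b`, where `v_a = ∑ j, α_j (loop j a) r_j` is the coefficient of `2 k_a` in
`∑ j, α_j q_j²`. -/
def linProd (s : Matrix (Fin n) (Fin n) ℝ) (a b : Fin L) : MvPolynomial (Fin p) ℝ :=
  ∑ j, ∑ l, MvPolynomial.C ((Γ.loop j a : ℝ) * (Γ.loop l b : ℝ) * Γ.extProd s j l) *
    (MvPolynomial.X j * MvPolynomial.X l)

/-- The second Symanzik polynomial (the mass independent part of `ℱ`): completing the square in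
`∑ j, α_j (m_j² - q_j²)` gives `𝒰⁻¹ ℱ̃ = vᵀ A⁻¹ v - ∑ j, α_j r_j²` besides `∑ j, α_j m_j²`. -/
def symanzikF (s : Matrix (Fin n) (Fin n) ℝ) : MvPolynomial (Fin p) ℝ :=
  (∑ a, ∑ b, Γ.loopMatrix.adjugate a b * Γ.linProd s a b) -
    Γ.symanzikU * ∑ j, MvPolynomial.C (Γ.extProd s j j) * MvPolynomial.X j

/-- `ℱ(α; x) = 𝒰(α) ∑ j, m_j² α_j + ℱ̃(α; x)`. The argument `m` lists the squared masses. -/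
def fullF (s : Matrix (Fin n) (Fin n) ℝ) (m : Fin p → ℂ) (α : Fin p → ℝ) : ℂ :=
  (MvPolynomial.eval α Γ.symanzikU : ℂ) * ∑ j, m j * (α j : ℂ) +
    (MvPolynomial.eval α (Γ.symanzikF s) : ℂ)

/-- The Schwinger integral along the ray `e^{iθ} (0,∞)` in all Schwinger parameters, without the
factor `e^{γ_E L ε}`:
`∏ j ∫ dα_j α_j^{ν_j - 1} / Γ(ν_j) 𝒰(α)^{-D/2} e^{-ℱ(α; x)/𝒰(α)}`
with `α` replaced by `e^{iθ} α`. The usual Schwinger integral has `θ = 0`;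
`θ = π/2` is the form that goes with the replacement of `m_j²` by `m_j² - iε`. -/
def schwinger (s : Matrix (Fin n) (Fin n) ℝ) (θ : ℝ) (m ν : Fin p → ℂ) (D : ℂ) : ℂ :=
  Complex.exp (Complex.I * θ * (∑ j, ν j - L * D / 2)) *
    ∫ α in {α : Fin p → ℝ | ∀ j, 0 < α j},
      (∏ j, (α j : ℂ) ^ (ν j - 1) / Complex.Gamma (ν j)) *
        (MvPolynomial.eval α Γ.symanzikU : ℂ) ^ (-D / 2) *
        Complex.exp (-(Complex.exp (Complex.I * θ) *
          (Γ.fullF s m α / (MvPolynomial.eval α Γ.symanzikU : ℂ))))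

/-- Complex squared masses for which the exponential in the Schwinger integral along the ray of
angle `θ` decays. For `θ = π/2` this contains all `m` with negative imaginary parts. -/
def decayMasses (s : Matrix (Fin n) (Fin n) ℝ) (θ : ℝ) : Set (Fin p → ℂ) :=
  {m | ∃ c : ℝ, 0 < c ∧ ∀ α : Fin p → ℝ, (∀ j, 0 < α j) →
    c * ∑ j, α j ≤ (Complex.exp (Complex.I * θ) *
      (Γ.fullF s m α / (MvPolynomial.eval α Γ.symanzikU : ℂ))).re}

/-- The complex squared masses for which some ray between `ℝ₊` and `i ℝ₊` can be used. -/
def schwingerMasses (s : Matrix (Fin n) (Fin n) ℝ) : Set (Fin p → ℂ) :=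
  {m | ∃ θ ∈ Set.Icc (0 : ℝ) (Real.pi / 2), m ∈ Γ.decayMasses s θ}

/-- A meromorphic continuation `num / den` of the Schwinger integral in the exponents `ν ∈ ℂᵖ` and
the dimension `D ∈ ℂ`, to a region `Re ν_j > lo_j`, `Re D < hi`. It is analytic in the masses, its
polar locus does not depend on them, and it agrees with the Schwinger integral for large `Re ν_j` and
`-Re D`, where that integral converges absolutely. -/
structure Continuation (s : Matrix (Fin n) (Fin n) ℝ) where
  lo : Fin p → ℝ
  hi : ℝ
  num : (Fin p → ℂ) × (Fin p → ℂ) × ℂ → ℂ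
  den : (Fin p → ℂ) × ℂ → ℂ
  num_analytic : AnalyticOnNhd ℂ num
    (Γ.schwingerMasses s ×ˢ {w | (∀ j, lo j < (w.1 j).re) ∧ w.2.re < hi})
  den_analytic : AnalyticOnNhd ℂ den {w | (∀ j, lo j < (w.1 j).re) ∧ w.2.re < hi}
  agree : ∃ B : ℝ, 0 ≤ B ∧ ∀ θ ∈ Set.Icc (0 : ℝ) (Real.pi / 2), ∀ m ∈ Γ.decayMasses s θ,
    ∀ ν : Fin p → ℂ, ∀ D : ℂ, (∀ j, lo j < (ν j).re ∧ B < (ν j).re) → D.re < hi → D.re < -B →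
      num (m, ν, D) = den (ν, D) * Γ.schwinger s θ m ν D

/-- `(ν, D)` lies in the region of the continuation, off its polar locus. -/
def Continuation.RegularAt {s : Matrix (Fin n) (Fin n) ℝ} {Γ : Family p L n}
    (C : Γ.Continuation s) (ν : Fin p → ℂ) (D : ℂ) : Prop :=
  (∀ j, C.lo j < (ν j).re) ∧ D.re < C.hi ∧ C.den (ν, D) ≠ 0

/-- The dimensionally regularised integral is finite at `(ν, D)`. -/
def IsRegular (s : Matrix (Fin n) (Fin n) ℝ) (ν : Fin p → ℂ) (D : ℂ) : Prop :=
  ∃ C : Γ.Continuation s, C.RegularAt ν D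

open Classical in
/-- The value at `(ν, D)` of the meromorphically continued Schwinger integral. By the identity
theorem it does not depend on the continuation, for `m ∈ schwingerMasses`. -/
def continued (s : Matrix (Fin n) (Fin n) ℝ) (m ν : Fin p → ℂ) (D : ℂ) : ℂ :=
  if h : Γ.IsRegular s ν D then h.choose.num (m, ν, D) / h.choose.den (ν, D) else 0

/-- The Feynman integral `I(x; ν; D)` at complex squared masses, in `D = D₀ - 2 ε` dimensions. -/
def integralC (s : Matrix (Fin n) (Fin n) ℝ) (ν : Fin p → ℤ) (D₀ : ℤ) (ε : ℂ)
    (m : Fin p → ℂ) : ℂ :=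
  Complex.exp (Real.eulerMascheroniConstant * L * ε) *
    Γ.continued s m (fun j => (ν j : ℂ)) (D₀ - 2 * ε)

/-- The squared masses `m_j² - i η` of the Feynman prescription. -/
def shifted (m : Fin p → ℝ) (η : ℝ) : Fin p → ℂ := fun j => (m j : ℂ) - Complex.I * η

/-- The Feynman integral `I(x; ν; D)`, `D = D₀ - 2 ε`, as a function of the real squared masses,
with the Feynman prescription `m_j² - i0`. -/
def integral (s : Matrix (Fin n) (Fin n) ℝ) (ν : Fin p → ℤ) (D₀ : ℤ) (ε : ℂ)
    (m : Fin p → ℝ) : ℂ :=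
  limUnder (𝓝[>] (0 : ℝ)) (fun η : ℝ => Γ.integralC s ν D₀ ε (shifted m η))

/-- Generic real squared masses: they do not lie on a singularity of `I(·; ν; D)`, that is,
the holomorphic function `I(·; ν; D)` on `{Im m_j² < 0}` continues analytically to a neighbourhood
of `m`. -/
def GenericMasses (s : Matrix (Fin n) (Fin n) ℝ) (ν : Fin p → ℤ) (D₀ : ℤ) (ε : ℂ)
    (m : Fin p → ℝ) : Prop :=
  ∃ g : (Fin p → ℂ) → ℂ, AnalyticAt ℂ g (fun j => (m j : ℂ)) ∧
    ∀ᶠ z in 𝓝[{z : Fin p → ℂ | ∀ j, (z j).im < 0}] (fun j => (m j : ℂ)),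
      Γ.integralC s ν D₀ ε z = g z

end Family

/-- The partial derivative in the variable `j`. -/
def pderiv {p : ℕ} (j : Fin p) (f : (Fin p → ℝ) → ℂ) : (Fin p → ℝ) → ℂ :=
  fun x => lineDeriv ℝ f x (Pi.single j 1)

/-- The iterated partial derivative `∂_1^{e_1} ⋯ ∂_p^{e_p} f`. -/
def monomialDeriv {p : ℕ} (e : Fin p →₀ ℕ) (f : (Fin p → ℝ) → ℂ) : (Fin p → ℝ) → ℂ :=
  (List.finRange p).foldr (fun j g => (pderiv j)^[e j] g) f

/-- The differential operator `Q(∂_1, …, ∂_p)` with constant coefficients. -/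
def diffOp {p : ℕ} (Q : MvPolynomial (Fin p) ℝ) (f : (Fin p → ℝ) → ℂ) : (Fin p → ℝ) → ℂ :=
  fun x => ∑ e ∈ Q.support, ((Q.coeff e : ℝ) : ℂ) * monomialDeriv e f x

end Feynman

end

/-! In the Schwinger integral the masses enter only through `e^{-e^{iθ} ∑ j, α_j m_j²}`, so
`∂/∂m_j²` multiplies the integrand by `-e^{iθ} α_j`. As `𝒰` is homogeneous of degree `L`, the
operator `𝒰(∂/∂m²)` multiplies it by `(-e^{iθ})^L 𝒰(α)`; up to the sign `(-1)^L`, this is the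
effect of replacing `D` by `D - 2` in `e^{iθ(∑ ν_j - L D/2)} 𝒰^{-D/2}`.

Applied to the numerator of a continuation at `D`, the same operator gives the numerator of a
continuation at `D - 2` with the same denominator, and by the identity theorem values do not depend
on the choice of continuation. At generic real masses the boundary values of the integral are those
of its analytic extension `g`, and `(-1)^L 𝒰(∂/∂m²) g` extends the integral at `D - 2`.
-/

noncomputable section

namespace Feynman

section DirectionalDerivatives

/-- The directional derivative along `v`, as an operator on functions. -/
def dirDeriv (𝕜 : Type*) [NontriviallyNormedField 𝕜] {E F : Type*} [AddCommGroup E] [Module 𝕜 E]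
    [NormedAddCommGroup F] [NormedSpace 𝕜 F] (v : E) (f : E → F) : E → F :=
  fun x => lineDeriv 𝕜 f x v

/-- The composition `T₁^{e₁} ∘ ⋯ ∘ T_p^{e_p}` of powers of operators that need not commute. -/
def monomialOp {p : ℕ} {β : Type*} (T : Fin p → β → β) (e : Fin p →₀ ℕ) (f : β) : β :=
  (List.finRange p).foldr (fun j g => (T j)^[e j] g) f

/-- The constant coefficient operator `Q(∂_{b₁}, …, ∂_{b_p})`, where `∂_v` is the derivative along
`v`; each monomial is ordered as in `monomialDeriv`. -/
def polyDeriv (𝕜 : Type*) [NontriviallyNormedField 𝕜] [NormedAlgebra 𝕜 ℂ] {E : Type*}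
    [AddCommGroup E] [Module 𝕜 E] {p : ℕ} (b : Fin p → E) (Q : MvPolynomial (Fin p) ℝ)
    (f : E → ℂ) : E → ℂ :=
  fun x => ∑ e ∈ Q.support, ((Q.coeff e : ℝ) : ℂ) *
    monomialOp (fun j => dirDeriv 𝕜 (b j)) e f x

variable {p : ℕ}

theorem diffOp_eq_polyDeriv (Q : MvPolynomial (Fin p) ℝ) (f : (Fin p → ℝ) → ℂ) :
    diffOp Q f = polyDeriv ℝ (fun j => Pi.single j 1) Q f :=
  rfl

theorem monomialOp_rel {β γ : Type*} {R : β → γ → Prop} {T : Fin p → β → β} {S : Fin p → γ → γ}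
    (hTS : ∀ j f g, R f g → R (T j f) (S j g)) (e : Fin p →₀ ℕ) {f : β} {g : γ} (hfg : R f g) :
    R (monomialOp T e f) (monomialOp S e g) := by
  refine List.foldr_rel hfg fun j _ f g hfg => ?_
  induction e j with
  | zero => exact hfg
  | succ k ih =>
    rw [Function.iterate_succ_apply', Function.iterate_succ_apply']
    exact hTS j _ _ ih

theorem monomialOp_mul_left {M : Type*} [CommMonoid M] (u : Fin p → M) (e : Fin p →₀ ℕ) (w : M) :
    monomialOp (fun j => (u j * ·)) e w = (∏ j, u j ^ e j) * w := by
  rw [monomialOp, Fin.prod_univ_def]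
  induction List.finRange p with
  | nil => simp
  | cons j l ih =>
    rw [List.foldr_cons, ih, mul_left_iterate, List.map_cons, List.prod_cons, mul_assoc]

section Field

variable {𝕜 : Type*} [NontriviallyNormedField 𝕜] [NormedAlgebra 𝕜 ℂ]

theorem polyDeriv_const_mul {E : Type*} [AddCommGroup E] [Module 𝕜 E] (b : Fin p → E)
    (Q : MvPolynomial (Fin p) ℝ) (c : ℂ) (f : E → ℂ) :
    polyDeriv 𝕜 b Q (fun x => c * f x) = fun x => c * polyDeriv 𝕜 b Q f x := by
  have monomial (e : Fin p →₀ ℕ) : monomialOp (fun j => dirDeriv 𝕜 (b j)) e (fun x => c * f x) =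
      fun x => c * monomialOp (fun j => dirDeriv 𝕜 (b j)) e f x := by
    refine monomialOp_rel (R := fun g f : E → ℂ => g = fun x => c * f x) ?_ e rfl
    rintro j _ f rfl
    exact funext fun x => deriv_const_mul_field c
  funext x
  simp only [polyDeriv, monomial, Finset.mul_sum, mul_left_comm]

theorem polyDeriv_comp {E E' : Type*} [AddCommGroup E] [Module 𝕜 E] [AddCommGroup E'] [Module 𝕜 E']
    {φ : E' → E} {b : Fin p → E} {b' : Fin p → E'}
    (hφ : ∀ j x (t : 𝕜), φ (x + t • b' j) = φ x + t • b j)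
    (Q : MvPolynomial (Fin p) ℝ) (f : E → ℂ) :
    polyDeriv 𝕜 b' Q (f ∘ φ) = polyDeriv 𝕜 b Q f ∘ φ := by
  have monomial (e : Fin p →₀ ℕ) : monomialOp (fun j => dirDeriv 𝕜 (b' j)) e (f ∘ φ) =
      monomialOp (fun j => dirDeriv 𝕜 (b j)) e f ∘ φ := by
    refine monomialOp_rel (R := fun (g : E' → ℂ) (f : E → ℂ) => g = f ∘ φ) ?_ e rfl
    rintro j _ f rfl
    funext x
    simp only [dirDeriv, lineDeriv, Function.comp_apply, hφ]
  funext x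
  simp only [polyDeriv, monomial, Function.comp_apply]

theorem polyDeriv_prodMk {E F : Type*} [AddCommGroup E] [Module 𝕜 E] [AddCommGroup F] [Module 𝕜 F]
    (b : Fin p → E) (Q : MvPolynomial (Fin p) ℝ) (f : E × F → ℂ) (x : E) (y : F) :
    polyDeriv 𝕜 (fun j => (b j, 0)) Q f (x, y) = polyDeriv 𝕜 b Q (fun z => f (z, y)) x :=
  (congrFun (polyDeriv_comp (φ := fun z => (z, y)) (by simp) Q f) x).symm

theorem polyDeriv_congr {E : Type*} [NormedAddCommGroup E] [NormedSpace 𝕜 E] (b : Fin p → E)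
    (Q : MvPolynomial (Fin p) ℝ) {f g : E → ℂ} {x : E} (hfg : f =ᶠ[𝓝 x] g) :
    polyDeriv 𝕜 b Q f x = polyDeriv 𝕜 b Q g x := by
  refine Finset.sum_congr rfl fun e _ => congrArg _ (EventuallyEq.eq_of_nhds (x := x) ?_)
  exact monomialOp_rel (R := fun f g : E → ℂ => f =ᶠ[𝓝 x] g)
    (fun j _ _ h => h.eventuallyEq_nhds.mono fun _ hy => hy.lineDeriv_eq (v := b j)) e hfg

end Field

variable {E : Type*} [NormedAddCommGroup E] [NormedSpace ℂ E]

theorem analyticAt_dirDeriv {f : E → ℂ} {x : E} (hf : AnalyticAt ℂ f x) (v : E) :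
    AnalyticAt ℂ (dirDeriv ℂ v f) x := by
  have fderiv_apply : AnalyticAt ℂ (fun y => fderiv ℂ f y v) x :=
    ((ContinuousLinearMap.apply ℂ ℂ v).analyticAt _).comp hf.fderiv
  refine fderiv_apply.congr ?_
  filter_upwards [hf.eventually_analyticAt] with y hy
  exact hy.differentiableAt.lineDeriv_eq_fderiv.symm

theorem analyticAt_polyDeriv {f : E → ℂ} {x : E} (hf : AnalyticAt ℂ f x) (b : Fin p → E)
    (Q : MvPolynomial (Fin p) ℝ) : AnalyticAt ℂ (polyDeriv ℂ b Q f) x :=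
  Finset.analyticAt_fun_sum _ fun e _ => analyticAt_const.mul <|
    monomialOp_rel (R := fun f (_ : Unit) => AnalyticAt ℂ f x) (S := fun _ => id)
      (fun j _ _ hf => analyticAt_dirDeriv hf (b j)) e (g := ()) hf

theorem dirDeriv_real_eq_complex {f : E → ℂ} {x : E} (hf : DifferentiableAt ℂ f x) (v : E) :
    dirDeriv ℝ v f x = dirDeriv ℂ v f x := by
  have := hf.lineDifferentiableAt.hasLineDerivAt (v := v)
  rw [HasLineDerivAt, ← Complex.ofReal_zero] at this
  simpa only [dirDeriv, lineDeriv, Complex.coe_smul] using this.comp_ofReal.deriv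

theorem polyDeriv_real_eq_complex {f : E → ℂ} {x : E} (hf : AnalyticAt ℂ f x) (b : Fin p → E)
    (Q : MvPolynomial (Fin p) ℝ) : polyDeriv ℝ b Q f x = polyDeriv ℂ b Q f x := by
  refine Finset.sum_congr rfl fun e _ => congrArg _ (EventuallyEq.eq_of_nhds (x := x) ?_)
  refine (monomialOp_rel (R := fun f g => AnalyticAt ℂ g x ∧ f =ᶠ[𝓝 x] g) ?_ e
    ⟨hf, .rfl⟩).2
  rintro j f g ⟨hg, hfg⟩
  refine ⟨analyticAt_dirDeriv hg (b j), ?_⟩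
  filter_upwards [hfg.eventuallyEq_nhds, hg.eventually_analyticAt] with y hy hgy
  exact hy.lineDeriv_eq.trans (dirDeriv_real_eq_complex hgy.differentiableAt (b j))

end DirectionalDerivatives

section LaplaceIntegrals

theorem exp_norm_le_sum_norm_exp (z : ℂ) :
    Real.exp ‖z‖ ≤ ‖Complex.exp (2 * z)‖ + ‖Complex.exp (-2 * z)‖ +
      (‖Complex.exp (-2 * Complex.I * z)‖ + ‖Complex.exp (2 * Complex.I * z)‖) := by
  have sq_exp (x : ℝ) : Real.exp |x| ^ 2 ≤ Real.exp (2 * x) + Real.exp (-(2 * x)) := by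
    rw [← Real.exp_nat_mul, Nat.cast_ofNat, ← abs_two, ← abs_mul, abs_two]
    exact Real.exp_abs_le _
  calc Real.exp ‖z‖ ≤ Real.exp (|z.re| + |z.im|) :=
        Real.exp_le_exp.2 z.norm_le_abs_re_add_abs_im
    _ ≤ Real.exp |z.re| ^ 2 + Real.exp |z.im| ^ 2 := by
        rw [Real.exp_add]
        nlinarith [two_mul_le_add_sq (Real.exp |z.re|) (Real.exp |z.im|),
          Real.exp_pos |z.re|, Real.exp_pos |z.im|]
    _ ≤ _ := by
        refine (add_le_add (sq_exp z.re) (sq_exp z.im)).trans_eq ?_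
        simp [Complex.norm_exp]

section Definitions

variable {X E : Type*} [AddCommGroup E] [Module ℂ E]

/-- The integrand of a Laplace integral `z ↦ ∫ w(x) e^{⟨ℓ(x), z⟩} dμ(x)` with weight `w` and
linear exponents `ℓ(x)`. -/
def laplaceIntegrand (ℓ : X → E →ₗ[ℂ] ℂ) (w : X → ℂ) (z : E) (x : X) : ℂ :=
  w x * Complex.exp (ℓ x z)

/-- The Laplace integral `z ↦ ∫ w(x) e^{⟨ℓ(x), z⟩} dμ(x)`. -/
def laplaceIntegral [MeasurableSpace X] (μ : Measure X) (ℓ : X → E →ₗ[ℂ] ℂ) (w : X → ℂ)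
    (z : E) : ℂ :=
  ∫ x, laplaceIntegrand ℓ w z x ∂μ

theorem laplaceIntegrand_mul_left {ℓ : X → E →ₗ[ℂ] ℂ} {w : X → ℂ} {z : E} (u : X → ℂ) :
    laplaceIntegrand ℓ (fun x => u x * w x) z = fun x => u x * laplaceIntegrand ℓ w z x :=
  funext fun _ => mul_assoc _ _ _

end Definitions

variable {X : Type*} [MeasurableSpace X] {μ : Measure X}

theorem integrable_mul_exp_norm {f g : X → ℂ} (hg : AEStronglyMeasurable g μ) {r : ℝ}
    (h : ∀ t : ℂ, ‖t‖ ≤ 2 * r → Integrable (fun x => f x * Complex.exp (t * g x)) μ) (hr : 0 ≤ r) :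
    Integrable (fun x => ‖f x‖ * Real.exp (r * ‖g x‖)) μ := by
  have hf : Integrable f μ := by simpa using h 0 (by simpa using hr)
  have norm_le (t : ℂ) (ht : ‖t‖ ≤ 2) := (h (t * r) (by
    rw [norm_mul, Complex.norm_real, Real.norm_of_nonneg hr]; gcongr)).norm
  refine (((norm_le 2 (by simp)).add (norm_le (-2) (by simp))).add
    ((norm_le (-2 * Complex.I) (by simp)).add (norm_le (2 * Complex.I) (by simp)))).mono' ?_
    (.of_forall fun x => ?_)
  · exact hf.aestronglyMeasurable.norm.mul
      (Real.continuous_exp.comp_aestronglyMeasurable (hg.norm.const_mul r))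
  · have := exp_norm_le_sum_norm_exp (r * g x)
    rw [norm_mul (r : ℂ), Complex.norm_real, Real.norm_of_nonneg hr] at this
    rw [Real.norm_of_nonneg (by positivity)]
    refine (mul_le_mul_of_nonneg_left this (norm_nonneg (f x))).trans_eq ?_
    simp only [Pi.add_apply, norm_mul (f x), mul_assoc, mul_add]

theorem hasDerivAt_integral_mul_exp {f g : X → ℂ} (hg : AEStronglyMeasurable g μ)
    (h : ∀ᶠ t : ℂ in 𝓝 0, Integrable (fun x => f x * Complex.exp (t * g x)) μ) :
    Integrable (fun x => g x * f x) μ ∧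
      HasDerivAt (fun t : ℂ => ∫ x, f x * Complex.exp (t * g x) ∂μ) (∫ x, g x * f x ∂μ) 0 := by
  obtain ⟨R, hR, hint⟩ := Metric.eventually_nhds_iff_ball.1 h
  have hr : 0 < R / 8 := by positivity
  have hf : Integrable f μ := by simpa using h.self_of_nhds
  have moment : Integrable (fun x => ‖f x‖ * Real.exp (2 * (R / 8) * ‖g x‖)) μ :=
    integrable_mul_exp_norm hg (fun t ht => hint t (by
      rw [mem_ball_zero_iff]; linarith)) (by positivity)
  have bound (x : X) (t : ℂ) (ht : t ∈ Metric.ball (0 : ℂ) (R / 8)) :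
      ‖g x * f x * Complex.exp (t * g x)‖ ≤
        (R / 8)⁻¹ * (‖f x‖ * Real.exp (2 * (R / 8) * ‖g x‖)) := by
    have hg_le : ‖g x‖ ≤ (R / 8)⁻¹ * Real.exp (R / 8 * ‖g x‖) := by
      rw [← div_eq_inv_mul, le_div_iff₀' hr]
      linarith [Real.add_one_le_exp (R / 8 * ‖g x‖)]
    have hexp_le : ‖Complex.exp (t * g x)‖ ≤ Real.exp (R / 8 * ‖g x‖) := by
      refine (Complex.norm_exp_le_exp_norm _).trans (Real.exp_le_exp.2 ?_)
      rw [norm_mul]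
      exact mul_le_mul_of_nonneg_right (mem_ball_zero_iff.1 ht).le (norm_nonneg _)
    calc ‖g x * f x * Complex.exp (t * g x)‖
        = ‖g x‖ * ‖f x‖ * ‖Complex.exp (t * g x)‖ := by rw [norm_mul, norm_mul]
      _ ≤ (R / 8)⁻¹ * Real.exp (R / 8 * ‖g x‖) * ‖f x‖ * Real.exp (R / 8 * ‖g x‖) := by gcongr
      _ = (R / 8)⁻¹ * (‖f x‖ * Real.exp (2 * (R / 8) * ‖g x‖)) := by
        rw [mul_assoc 2, two_mul, Real.exp_add]
        ring
  have differentiated := hasDerivAt_integral_of_dominated_loc_of_deriv_le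
    (Metric.ball_mem_nhds 0 hr)
    (F := fun t x => f x * Complex.exp (t * g x))
    (F' := fun t x => g x * f x * Complex.exp (t * g x))
    (h.mono fun t ht => ht.aestronglyMeasurable) h.self_of_nhds
    (by simpa [Pi.mul_def] using hg.mul hf.aestronglyMeasurable)
    (.of_forall bound) (moment.const_mul _)
    (.of_forall fun x t _ => ((hasDerivAt_mul_const (g x)).cexp.const_mul (f x)).congr_deriv
      (by ring))
  simpa using differentiated

variable {E : Type*} [NormedAddCommGroup E] [NormedSpace ℂ E] {ℓ : X → E →ₗ[ℂ] ℂ} {w : X → ℂ}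
  {z v : E}

theorem hasLineDerivAt_laplaceIntegral (hv : AEStronglyMeasurable (fun x => ℓ x v) μ)
    (hint : ∀ᶠ z' in 𝓝 z, Integrable (laplaceIntegrand ℓ w z') μ) :
    Integrable (laplaceIntegrand ℓ (fun x => ℓ x v * w x) z) μ ∧
      HasLineDerivAt ℂ (laplaceIntegral μ ℓ w) (laplaceIntegral μ ℓ (fun x => ℓ x v * w x) z)
        z v := by
  have along_line (t : ℂ) (x : X) : laplaceIntegrand ℓ w (z + t • v) x =
      laplaceIntegrand ℓ w z x * Complex.exp (t * ℓ x v) := by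
    simp only [laplaceIntegrand, map_add, map_smul, smul_eq_mul, Complex.exp_add, mul_assoc]
  have line_tendsto : Tendsto (fun t : ℂ => z + t • v) (𝓝 0) (𝓝 z) :=
    Continuous.tendsto' (by fun_prop) _ _ (by simp)
  have along_line_deriv := hasDerivAt_integral_mul_exp hv (f := laplaceIntegrand ℓ w z)
    ((line_tendsto.eventually hint).mono fun t ht => ht.congr (.of_forall (along_line t)))
  simp only [← along_line] at along_line_deriv
  simpa only [HasLineDerivAt, laplaceIntegral, laplaceIntegrand_mul_left] using along_line_deriv

theorem monomialOp_dirDeriv_laplaceIntegral {p : ℕ} {b : Fin p → E}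
    (hb : ∀ j, AEStronglyMeasurable (fun x => ℓ x (b j)) μ)
    (hint : ∀ᶠ z' in 𝓝 z, Integrable (laplaceIntegrand ℓ w z') μ) (e : Fin p →₀ ℕ) :
    Integrable (laplaceIntegrand ℓ (fun x => (∏ j, ℓ x (b j) ^ e j) * w x) z) μ ∧
      monomialOp (fun j => dirDeriv ℂ (b j)) e (laplaceIntegral μ ℓ w) z =
        laplaceIntegral μ ℓ (fun x => (∏ j, ℓ x (b j) ^ e j) * w x) z := by
  have iterated := monomialOp_rel (T := fun j => dirDeriv ℂ (b j))
    (S := fun j => ((fun x => ℓ x (b j)) * ·))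
    (R := fun g w => (∀ᶠ z' in 𝓝 z, Integrable (laplaceIntegrand ℓ w z') μ) ∧
      g =ᶠ[𝓝 z] laplaceIntegral μ ℓ w) (fun j g w ⟨hw, hg⟩ => ?_) e ⟨hint, .rfl⟩
  · rw [monomialOp_mul_left] at iterated
    simpa [Pi.mul_def, Finset.prod_fn] using And.intro iterated.1.self_of_nhds iterated.2.eq_of_nhds
  · have deriv := hw.eventually_nhds.mono fun y hy => hasLineDerivAt_laplaceIntegral (hb j) hy
    refine ⟨deriv.mono fun y hy => hy.1, ?_⟩
    filter_upwards [hg.eventuallyEq_nhds, deriv] with y hgy hy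
    exact hgy.lineDeriv_eq.trans hy.2.lineDeriv

theorem polyDeriv_laplaceIntegral {p : ℕ} {b : Fin p → E}
    (hb : ∀ j, AEStronglyMeasurable (fun x => ℓ x (b j)) μ)
    (hint : ∀ᶠ z' in 𝓝 z, Integrable (laplaceIntegrand ℓ w z') μ)
    (Q : MvPolynomial (Fin p) ℝ) :
    polyDeriv ℂ b Q (laplaceIntegral μ ℓ w) z =
      laplaceIntegral μ ℓ (fun x => MvPolynomial.aeval (fun j => ℓ x (b j)) Q * w x) z := by
  have monomial := monomialOp_dirDeriv_laplaceIntegral hb hint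
  simp only [polyDeriv, (monomial _).2, laplaceIntegral, ← integral_const_mul]
  rw [← integral_finsetSum _ fun e _ => (monomial e).1.const_mul _]
  simp only [laplaceIntegrand, MvPolynomial.aeval_def, MvPolynomial.eval₂_eq', Finset.sum_mul,
    mul_assoc, Complex.coe_algebraMap]

end LaplaceIntegrals

section Orthant

variable {ι : Type*}

theorem measurableSet_orthant [Countable ι] : MeasurableSet {α : ι → ℝ | ∀ j, 0 < α j} := by
  rw [Set.ofPred_forall]
  exact .iInter fun j => measurableSet_lt measurable_const (measurable_pi_apply j)

variable [Fintype ι]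

theorem integrableOn_prod_rpow_mul_exp {r : ι → ℝ} (hr : ∀ j, -1 < r j) {c : ℝ} (hc : 0 < c) :
    IntegrableOn (fun α : ι → ℝ => (∏ j, α j ^ r j) * Real.exp (-(c * ∑ j, α j)))
      {α | ∀ j, 0 < α j} := by
  have orthant_eq : {α : ι → ℝ | ∀ j, 0 < α j} = Set.univ.pi fun _ => Set.Ioi 0 := by
    ext; simp
  rw [IntegrableOn, orthant_eq, volume_pi, Measure.restrict_pi_pi]
  have factors := Integrable.fintype_prod (f := fun j (x : ℝ) => x ^ r j * Real.exp (-c * x))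
    (μ := fun _ => volume.restrict (Set.Ioi 0)) fun j => by
      simpa [IntegrableOn] using integrableOn_rpow_mul_exp_neg_mul_rpow (hr j) zero_lt_one hc
  refine factors.congr (.of_forall fun α => ?_)
  simp only [Finset.prod_mul_distrib, ← Real.exp_sum, Finset.mul_sum, neg_mul,
    Finset.sum_neg_distrib]

theorem integrableOn_prod_rpow_mul_eval_mul_exp {r : ι → ℝ} (hr : ∀ j, -1 < r j) {c : ℝ}
    (hc : 0 < c) (Q : MvPolynomial ι ℝ) :
    IntegrableOn (fun α : ι → ℝ =>
        (∏ j, α j ^ r j) * MvPolynomial.eval α Q * Real.exp (-(c * ∑ j, α j)))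
      {α | ∀ j, 0 < α j} := by
  have monomials : IntegrableOn (fun α : ι → ℝ => ∑ e ∈ Q.support,
      Q.coeff e * ((∏ j, α j ^ (r j + e j)) * Real.exp (-(c * ∑ j, α j)))) {α | ∀ j, 0 < α j} :=
    integrable_finsetSum _ fun e _ =>
      (integrableOn_prod_rpow_mul_exp (fun j => by linarith [hr j, (e j).cast_nonneg (α := ℝ)])
        hc).const_mul _
  refine monomials.congr_fun (fun α hα => ?_) measurableSet_orthant
  have rpow_add (e : ι →₀ ℕ) : ∏ j, α j ^ (r j + e j) = (∏ j, α j ^ r j) * ∏ j, α j ^ e j := by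
    rw [← Finset.prod_mul_distrib]
    exact Finset.prod_congr rfl fun j _ => Real.rpow_add_natCast (hα j).ne' _ _
  simp only [rpow_add, MvPolynomial.eval_eq', Finset.mul_sum, Finset.sum_mul]
  exact Finset.sum_congr rfl fun e _ => by ring

theorem rpow_le_one_add_pow {x r : ℝ} {N : ℕ} (hx : 0 < x) (hr : 0 ≤ r) (hN : r ≤ N) :
    x ^ r ≤ 1 + x ^ N := by
  rcases le_total x 1 with hx1 | hx1
  · exact (Real.rpow_le_one hx.le hx1 hr).trans (le_add_of_nonneg_right (by positivity))
  · exact (Real.rpow_le_rpow_of_exponent_le hx1 hN).trans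
      ((Real.rpow_natCast x N).trans_le (le_add_of_nonneg_left zero_le_one))

end Orthant

namespace Family

variable {p L n : ℕ} (Γ : Family p L n)

section Symanzik

/-- The `p × L` matrix of the coefficients of the loop momenta in the propagator momenta. -/
def loopCoeffs : Matrix (Fin p) (Fin L) ℝ :=
  .of fun j a => (Γ.loop j a : ℝ)

theorem aeval_symanzikU {R : Type*} [CommRing R] [Algebra ℝ R] (z : Fin p → R) :
    MvPolynomial.aeval z Γ.symanzikU = ((Γ.loopCoeffs.map (algebraMap ℝ R)).transpose *
      Matrix.diagonal z * Γ.loopCoeffs.map (algebraMap ℝ R)).det := by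
  rw [symanzikU, AlgHom.map_det]
  congr 1
  ext a b
  rw [Matrix.mul_apply]
  simp [loopMatrix, loopCoeffs, Matrix.mul_diagonal, mul_right_comm]

theorem aeval_smul_symanzikU {R : Type*} [CommRing R] [Algebra ℝ R] (c : R) (z : Fin p → R) :
    MvPolynomial.aeval (c • z) Γ.symanzikU = c ^ L * MvPolynomial.aeval z Γ.symanzikU := by
  rw [aeval_symanzikU, aeval_symanzikU, Matrix.diagonal_smul, Matrix.mul_smul, Matrix.smul_mul,
    Matrix.det_smul, Fintype.card_fin]

theorem symanzikU_pos {α : Fin p → ℝ} (hα : ∀ j, 0 < α j) :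
    0 < MvPolynomial.eval α Γ.symanzikU := by
  have loopCoeffs_injective : Function.Injective Γ.loopCoeffs.mulVec :=
    Matrix.mulVec_injective_iff.2 Γ.loop_indep
  have := ((Matrix.PosDef.diagonal hα).conjTranspose_mul_mul_same loopCoeffs_injective).det_pos
  simpa [← MvPolynomial.aeval_eq_eval, aeval_symanzikU,
    Matrix.conjTranspose_eq_transpose_of_trivial] using this

theorem symanzikU_ne_zero {α : Fin p → ℝ} (hα : ∀ j, 0 < α j) :
    (MvPolynomial.eval α Γ.symanzikU : ℂ) ≠ 0 :=
  Complex.ofReal_ne_zero.2 (Γ.symanzikU_pos hα).ne'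

end Symanzik

section Schwinger

variable {s : Matrix (Fin n) (Fin n) ℝ} {θ : ℝ} {m ν : Fin p → ℂ} {D : ℂ}

/-- The linear form `m ↦ -e^{iθ} ∑ j, α_j m_j`, the mass dependent part of the exponent
`-e^{iθ} ℱ / 𝒰` of the Schwinger integral. -/
def massPairing (θ : ℝ) (α : Fin p → ℝ) : (Fin p → ℂ) →ₗ[ℂ] ℂ :=
  Fintype.linearCombination ℂ (-Complex.exp (Complex.I * θ) • fun j => (α j : ℂ))

theorem norm_massPairing_le {α : Fin p → ℝ} (hα : ∀ j, 0 < α j) (z : Fin p → ℂ) :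
    ‖massPairing θ α z‖ ≤ ‖z‖ * ∑ j, α j := by
  rw [massPairing, Fintype.linearCombination_apply, Finset.mul_sum]
  refine norm_sum_le_of_le _ fun j _ => ?_
  have norm_phase : ‖Complex.exp (Complex.I * θ)‖ = 1 := by
    rw [mul_comm, Complex.norm_exp_ofReal_mul_I]
  simp only [Pi.smul_apply, norm_smul, norm_neg, norm_phase, one_mul, Complex.norm_real,
    Real.norm_of_nonneg (hα j).le]
  exact mul_le_mul_of_nonneg_right (norm_le_pi_norm z j) (hα j).le

theorem exp_mul_fullF_div_symanzikU {α : Fin p → ℝ} (hα : ∀ j, 0 < α j) :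
    Complex.exp (Complex.I * θ) * (Γ.fullF s m α / (MvPolynomial.eval α Γ.symanzikU : ℂ)) =
      Complex.exp (Complex.I * θ) * ((MvPolynomial.eval α (Γ.symanzikF s) : ℂ) /
        (MvPolynomial.eval α Γ.symanzikU : ℂ)) - massPairing θ α m := by
  rw [fullF, add_div, mul_div_cancel_left₀ _ (Γ.symanzikU_ne_zero hα), massPairing,
    Fintype.linearCombination_apply]
  simp only [Pi.smul_apply, smul_eq_mul, neg_mul, mul_neg, Finset.sum_neg_distrib,
    mul_left_comm _ (Complex.exp _), ← Finset.mul_sum]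
  ring

theorem isOpen_decayMasses : IsOpen (Γ.decayMasses s θ) := by
  refine Metric.isOpen_iff.2 fun m ⟨c, hc, hdecay⟩ => ⟨c / 2, half_pos hc, fun m' hm' =>
    ⟨c / 2, half_pos hc, fun α hα => ?_⟩⟩
  have perturbation : (massPairing θ α (m' - m)).re ≤ c / 2 * ∑ j, α j := by
    refine (Complex.re_le_norm _).trans ((norm_massPairing_le hα _).trans ?_)
    have := Finset.sum_nonneg fun j (_ : j ∈ Finset.univ) => (hα j).le
    gcongr
    exact (mem_ball_iff_norm.1 hm').le
  have decay := hdecay α hα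
  rw [Γ.exp_mul_fullF_div_symanzikU hα, Complex.sub_re] at decay ⊢
  rw [map_sub, Complex.sub_re] at perturbation
  linarith

theorem isOpen_schwingerMasses : IsOpen (Γ.schwingerMasses s) := by
  have : Γ.schwingerMasses s = ⋃ θ ∈ Set.Icc (0 : ℝ) (Real.pi / 2), Γ.decayMasses s θ := by
    ext
    simp only [schwingerMasses, Set.mem_iUnion, exists_prop, Set.mem_ofPred_eq]
  rw [this]
  exact isOpen_biUnion fun θ _ => Γ.isOpen_decayMasses

/-- The mass independent factor of the Schwinger integrand, including the prefactor
`e^{iθ (∑ j, ν_j - L D / 2)}`. -/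
def schwingerWeight (s : Matrix (Fin n) (Fin n) ℝ) (θ : ℝ) (ν : Fin p → ℂ) (D : ℂ)
    (α : Fin p → ℝ) : ℂ :=
  Complex.exp (Complex.I * θ * (∑ j, ν j - L * D / 2)) *
    ((∏ j, (α j : ℂ) ^ (ν j - 1) / Complex.Gamma (ν j)) *
      (MvPolynomial.eval α Γ.symanzikU : ℂ) ^ (-D / 2) *
      Complex.exp (-(Complex.exp (Complex.I * θ) * ((MvPolynomial.eval α (Γ.symanzikF s) : ℂ) /
        (MvPolynomial.eval α Γ.symanzikU : ℂ)))))

theorem laplaceIntegrand_schwingerWeight {α : Fin p → ℝ} (hα : ∀ j, 0 < α j) :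
    laplaceIntegrand (massPairing θ) (Γ.schwingerWeight s θ ν D) m α =
      Complex.exp (Complex.I * θ * (∑ j, ν j - L * D / 2)) *
        ((∏ j, (α j : ℂ) ^ (ν j - 1) / Complex.Gamma (ν j)) *
          (MvPolynomial.eval α Γ.symanzikU : ℂ) ^ (-D / 2) *
          Complex.exp (-(Complex.exp (Complex.I * θ) *
            (Γ.fullF s m α / (MvPolynomial.eval α Γ.symanzikU : ℂ))))) := by
  rw [Γ.exp_mul_fullF_div_symanzikU hα, neg_sub', sub_neg_eq_add, Complex.exp_add]
  simp only [laplaceIntegrand, schwingerWeight, mul_assoc]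

theorem schwinger_eq_laplaceIntegral (m ν : Fin p → ℂ) (D : ℂ) :
    Γ.schwinger s θ m ν D =
      laplaceIntegral (volume.restrict {α | ∀ j, 0 < α j}) (massPairing θ)
        (Γ.schwingerWeight s θ ν D) m := by
  rw [schwinger, laplaceIntegral, ← integral_const_mul]
  exact setIntegral_congr_fun measurableSet_orthant fun α hα =>
    (Γ.laplaceIntegrand_schwingerWeight hα).symm

theorem measurable_laplaceIntegrand_schwingerWeight :
    Measurable (laplaceIntegrand (massPairing θ) (Γ.schwingerWeight s θ ν D) m) := by
  have eval_measurable (Q : MvPolynomial (Fin p) ℝ) : Measurable fun α => MvPolynomial.eval α Q :=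
    (MvPolynomial.continuous_eval Q).measurable
  have := eval_measurable Γ.symanzikU
  have := eval_measurable (Γ.symanzikF s)
  unfold laplaceIntegrand schwingerWeight massPairing
  simp only [Fintype.linearCombination_apply, Pi.smul_apply]
  fun_prop

theorem norm_laplaceIntegrand_schwingerWeight_le {c : ℝ} {α : Fin p → ℝ} (hα : ∀ j, 0 < α j)
    (hD : D.re ≤ 0) {N : ℕ} (hN : -D.re / 2 ≤ N)
    (hc : c * ∑ j, α j ≤ (Complex.exp (Complex.I * θ) *
      (Γ.fullF s m α / (MvPolynomial.eval α Γ.symanzikU : ℂ))).re) :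
    ‖laplaceIntegrand (massPairing θ) (Γ.schwingerWeight s θ ν D) m α‖ ≤
      ‖Complex.exp (Complex.I * θ * (∑ j, ν j - L * D / 2))‖ * ‖∏ j, (Complex.Gamma (ν j))⁻¹‖ *
        ((∏ j, α j ^ ((ν j).re - 1)) * MvPolynomial.eval α (1 + Γ.symanzikU ^ N) *
          Real.exp (-(c * ∑ j, α j))) := by
  have re_exponent : (-D / 2).re = -D.re / 2 := by simp
  have norm_powers : ‖∏ j, (α j : ℂ) ^ (ν j - 1)‖ = ∏ j, α j ^ ((ν j).re - 1) := by
    rw [norm_prod]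
    exact Finset.prod_congr rfl fun j _ => by
      rw [Complex.norm_cpow_eq_rpow_re_of_pos (hα j), Complex.sub_re, Complex.one_re]
  have norm_symanzikU : ‖(MvPolynomial.eval α Γ.symanzikU : ℂ) ^ (-D / 2)‖ ≤
      MvPolynomial.eval α (1 + Γ.symanzikU ^ N) := by
    rw [Complex.norm_cpow_eq_rpow_re_of_pos (Γ.symanzikU_pos hα), re_exponent, map_add, map_one,
      map_pow]
    exact rpow_le_one_add_pow (Γ.symanzikU_pos hα) (by linarith) hN
  have := Finset.prod_nonneg fun j (_ : j ∈ Finset.univ) =>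
    Real.rpow_nonneg (hα j).le ((ν j).re - 1)
  have := (norm_nonneg _).trans norm_symanzikU
  simp only [Γ.laplaceIntegrand_schwingerWeight hα, div_eq_mul_inv _ (Complex.Gamma _),
    Finset.prod_mul_distrib]
  rw [norm_mul, norm_mul, norm_mul, norm_mul, norm_powers, Complex.norm_exp (-_), Complex.neg_re,
    mul_comm (∏ j, α j ^ _), mul_assoc ‖_‖, mul_assoc ‖_‖, mul_assoc ‖_‖]
  gcongr

theorem integrable_laplaceIntegrand_schwingerWeight (hν : ∀ j, 0 < (ν j).re) (hD : D.re ≤ 0)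
    (hm : m ∈ Γ.decayMasses s θ) :
    Integrable (laplaceIntegrand (massPairing θ) (Γ.schwingerWeight s θ ν D) m)
      (volume.restrict {α | ∀ j, 0 < α j}) := by
  obtain ⟨c, hc, hdecay⟩ := hm
  obtain ⟨N, hN⟩ := exists_nat_ge (-D.re / 2)
  have majorant := integrableOn_prod_rpow_mul_eval_mul_exp (r := fun j => (ν j).re - 1)
    (fun j => by linarith [hν j]) hc (1 + Γ.symanzikU ^ N)
  exact (majorant.const_mul _).mono'
    Γ.measurable_laplaceIntegrand_schwingerWeight.aestronglyMeasurable <|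
    ae_restrict_of_forall_mem measurableSet_orthant fun α hα =>
      Γ.norm_laplaceIntegrand_schwingerWeight_le hα hD hN (hdecay α hα)

theorem aeval_massPairing_symanzikU_mul_schwingerWeight {α : Fin p → ℝ} (hα : ∀ j, 0 < α j) :
    MvPolynomial.aeval (fun j => massPairing θ α (Pi.single j 1)) Γ.symanzikU *
      Γ.schwingerWeight s θ ν (D + 2) α = (-1) ^ L * Γ.schwingerWeight s θ ν D α := by
  have aeval_ofReal : MvPolynomial.aeval (fun j => (α j : ℂ)) Γ.symanzikU =
      (MvPolynomial.eval α Γ.symanzikU : ℂ) := by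
    simpa [MvPolynomial.aeval_eq_eval, Function.comp_def] using
      MvPolynomial.aeval_algebraMap_apply (A := ℝ) ℂ α Γ.symanzikU
  have symanzikU_power : (MvPolynomial.eval α Γ.symanzikU : ℂ) ^ (-D / 2) =
      MvPolynomial.eval α Γ.symanzikU * (MvPolynomial.eval α Γ.symanzikU : ℂ) ^ (-(D + 2) / 2) := by
    rw [show -D / 2 = 1 + -(D + 2) / 2 by ring, Complex.cpow_add _ _ (Γ.symanzikU_ne_zero hα),
      Complex.cpow_one]
  have phase : Complex.exp (Complex.I * θ * (∑ j, ν j - L * D / 2)) =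
      Complex.exp (Complex.I * θ) ^ L *
        Complex.exp (Complex.I * θ * (∑ j, ν j - L * (D + 2) / 2)) := by
    rw [← Complex.exp_nat_mul, ← Complex.exp_add]
    ring_nf
  have massPairing_single : (fun j => massPairing θ α (Pi.single j 1)) =
      (-Complex.exp (Complex.I * θ)) • fun j => (α j : ℂ) := by
    funext j
    rw [massPairing, Fintype.linearCombination_apply_single, one_smul]
  rw [massPairing_single, aeval_smul_symanzikU, aeval_ofReal, schwingerWeight, schwingerWeight,
    symanzikU_power, phase, neg_pow]
  ring

theorem polyDeriv_schwinger (hν : ∀ j, 0 < (ν j).re) (hD : (D + 2).re ≤ 0)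
    (hm : m ∈ Γ.decayMasses s θ) :
    polyDeriv ℂ (fun j => Pi.single j 1) Γ.symanzikU (fun m => Γ.schwinger s θ m ν (D + 2)) m =
      (-1) ^ L * Γ.schwinger s θ m ν D := by
  simp only [schwinger_eq_laplaceIntegral]
  rw [polyDeriv_laplaceIntegral, laplaceIntegral, laplaceIntegral, ← integral_const_mul]
  · refine setIntegral_congr_fun measurableSet_orthant fun α hα => ?_
    simp only [laplaceIntegrand, Γ.aeval_massPairing_symanzikU_mul_schwingerWeight hα, mul_assoc]
  · intro j
    simp only [massPairing, Fintype.linearCombination_apply_single, Pi.smul_apply]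
    exact Measurable.aestronglyMeasurable (by fun_prop)
  · filter_upwards [Γ.isOpen_decayMasses.mem_nhds hm] with m' hm'
    exact Γ.integrable_laplaceIntegrand_schwingerWeight hν hD hm'

end Schwinger

end Family

section Region

variable {p : ℕ}

/-- The region `Re ν_j > lo_j`, `Re D < hi` of exponents and dimensions, as in `Continuation`. -/
def region (lo : Fin p → ℝ) (hi : ℝ) : Set ((Fin p → ℂ) × ℂ) :=
  {w | (∀ j, lo j < (w.1 j).re) ∧ w.2.re < hi}

theorem region_eq_prod (lo : Fin p → ℝ) (hi : ℝ) :
    region lo hi = (Set.univ.pi fun j => {z : ℂ | lo j < z.re}) ×ˢ {z : ℂ | z.re < hi} := by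
  ext
  simp [region]

theorem isOpen_region (lo : Fin p → ℝ) (hi : ℝ) : IsOpen (region lo hi) := by
  rw [region_eq_prod]
  exact (isOpen_set_pi Set.finite_univ fun j _ => isOpen_lt continuous_const
    Complex.continuous_re).prod (isOpen_lt Complex.continuous_re continuous_const)

theorem convex_region (lo : Fin p → ℝ) (hi : ℝ) : Convex ℝ (region lo hi) := by
  rw [region_eq_prod]
  exact (convex_pi fun j _ => convex_halfSpace_re_gt (lo j)).prod (convex_halfSpace_re_lt hi)

theorem region_nonempty (lo : Fin p → ℝ) (hi : ℝ) : (region lo hi).Nonempty :=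
  ⟨(fun j => (lo j + 1 : ℝ), (hi - 1 : ℝ)), by simp [region]⟩

theorem region_inter (lo lo' : Fin p → ℝ) (hi hi' : ℝ) :
    region lo hi ∩ region lo' hi' = region (lo ⊔ lo') (hi ⊓ hi') := by
  ext
  simp only [region, Set.mem_inter_iff, Set.mem_ofPred_eq, Pi.sup_apply, sup_lt_iff, lt_inf_iff,
    forall_and]
  tauto

end Region

namespace Family

variable {p L n : ℕ} {Γ : Family p L n} {s : Matrix (Fin n) (Fin n) ℝ}

namespace Continuation

theorem exists_num_eq (C : Γ.Continuation s) {θ : ℝ} (hθ : θ ∈ Set.Icc 0 (Real.pi / 2))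
    {m : Fin p → ℂ} (hm : m ∈ Γ.decayMasses s θ) :
    ∃ lo hi, region lo hi ⊆ region C.lo C.hi ∧
      ∀ w ∈ region lo hi, C.num (m, w) = C.den w * Γ.schwinger s θ m w.1 w.2 := by
  obtain ⟨B, -, hB⟩ := C.agree
  refine ⟨C.lo ⊔ fun _ => B, C.hi ⊓ -B, ?_, fun w hw => ?_⟩
  · rw [← region_inter]
    exact Set.inter_subset_left
  · rw [← region_inter] at hw
    exact hB θ hθ m hm w.1 w.2 (fun j => ⟨hw.1.1 j, hw.2.1 j⟩) hw.1.2 hw.2.2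

theorem analyticOnNhd_num_mk (C : Γ.Continuation s) {m : Fin p → ℂ}
    (hm : m ∈ Γ.schwingerMasses s) :
    AnalyticOnNhd ℂ (fun w => C.num (m, w)) (region C.lo C.hi) :=
  fun w hw => (C.num_analytic (m, w) ⟨hm, hw⟩).fun_comp (f := fun w => (m, w)) (by fun_prop)

theorem num_mul_den (C₁ C₂ : Γ.Continuation s) {m : Fin p → ℂ} (hm : m ∈ Γ.schwingerMasses s)
    {w : (Fin p → ℂ) × ℂ} (hw₁ : w ∈ region C₁.lo C₁.hi) (hw₂ : w ∈ region C₂.lo C₂.hi) :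
    C₁.num (m, w) * C₂.den w = C₂.num (m, w) * C₁.den w := by
  obtain ⟨θ, hθ, hmθ⟩ := id hm
  obtain ⟨lo₁, hi₁, hsub₁, hnum₁⟩ := C₁.exists_num_eq hθ hmθ
  obtain ⟨lo₂, hi₂, hsub₂, hnum₂⟩ := C₂.exists_num_eq hθ hmθ
  obtain ⟨w₀, hw₀⟩ := region_nonempty (lo₁ ⊔ lo₂) (hi₁ ⊓ hi₂)
  have eq_near_w₀ : (fun w => C₁.num (m, w) * C₂.den w) =ᶠ[𝓝 w₀]
      fun w => C₂.num (m, w) * C₁.den w := by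
    filter_upwards [(isOpen_region _ _).mem_nhds hw₀] with w hw
    rw [← region_inter] at hw
    rw [hnum₁ w hw.1, hnum₂ w hw.2]
    ring
  rw [← region_inter] at hw₀
  exact AnalyticOnNhd.eqOn_of_preconnected_of_eventuallyEq
    (U := region C₁.lo C₁.hi ∩ region C₂.lo C₂.hi)
    (fun w hw => (C₁.analyticOnNhd_num_mk hm w hw.1).mul (C₂.den_analytic w hw.2))
    (fun w hw => (C₂.analyticOnNhd_num_mk hm w hw.2).mul (C₁.den_analytic w hw.1))
    ((convex_region _ _).inter (convex_region _ _)).isPreconnected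
    ⟨hsub₁ hw₀.1, hsub₂ hw₀.2⟩ eq_near_w₀ ⟨hw₁, hw₂⟩

/-- The numerator `(-1)^L 𝒰(∂/∂m²) N(m², ν, D + 2)` of the continuation in two dimensions less. -/
def lowerNum (C : Γ.Continuation s) (x : (Fin p → ℂ) × (Fin p → ℂ) × ℂ) : ℂ :=
  (-1) ^ L * polyDeriv ℂ (fun j => (Pi.single j 1, 0)) Γ.symanzikU C.num (x.1, x.2.1, x.2.2 + 2)

theorem lowerNum_mk (C : Γ.Continuation s) (m ν : Fin p → ℂ) (D : ℂ) :
    C.lowerNum (m, ν, D) = (-1) ^ L * polyDeriv ℂ (fun j => Pi.single j 1) Γ.symanzikU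
      (fun m => C.num (m, ν, D + 2)) m := by
  rw [lowerNum, polyDeriv_prodMk]

theorem add_two_mem_region {C : Γ.Continuation s} {w : (Fin p → ℂ) × ℂ} :
    (w.1, w.2 + 2) ∈ region C.lo C.hi ↔ w ∈ region C.lo (C.hi - 2) := by
  simp [region, lt_sub_iff_add_lt]

theorem lowerNum_eq_den_mul_schwinger (C : Γ.Continuation s) {B : ℝ} (hB : 0 ≤ B)
    {θ : ℝ}
    (hagree : ∀ m ∈ Γ.decayMasses s θ, ∀ ν : Fin p → ℂ, ∀ D : ℂ,
      (∀ j, C.lo j < (ν j).re ∧ B < (ν j).re) → D.re < C.hi → D.re < -B →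
        C.num (m, ν, D) = C.den (ν, D) * Γ.schwinger s θ m ν D)
    {m ν : Fin p → ℂ} (hm : m ∈ Γ.decayMasses s θ) {D : ℂ}
    (hν : ∀ j, C.lo j < (ν j).re ∧ B < (ν j).re) (hhi : (D + 2).re < C.hi)
    (hD : (D + 2).re < -B) :
    C.lowerNum (m, ν, D) = C.den (ν, D + 2) * Γ.schwinger s θ m ν D := by
  have num_eq : (fun m => C.num (m, ν, D + 2)) =ᶠ[𝓝 m]
      fun m => C.den (ν, D + 2) * Γ.schwinger s θ m ν (D + 2) := by
    filter_upwards [Γ.isOpen_decayMasses.mem_nhds hm] with m' hm'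
    exact hagree m' hm' ν (D + 2) hν hhi hD
  rw [lowerNum_mk, polyDeriv_congr _ _ num_eq, polyDeriv_const_mul]
  beta_reduce
  rw [Γ.polyDeriv_schwinger (fun j => hB.trans_lt (hν j).2) (by linarith) hm, mul_left_comm,
    ← mul_assoc ((-1) ^ L), ← mul_pow, neg_one_mul, neg_neg, one_pow, one_mul]

/-- The continuation of the Schwinger integral in two dimensions less. -/
def lower (C : Γ.Continuation s) : Γ.Continuation s where
  lo := C.lo
  hi := C.hi - 2
  num := C.lowerNum
  den := fun w => C.den (w.1, w.2 + 2)
  num_analytic := fun x ⟨hm, hw⟩ => analyticAt_const.mul <|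
    (analyticAt_polyDeriv (C.num_analytic (x.1, x.2.1, x.2.2 + 2)
      ⟨hm, add_two_mem_region.2 hw⟩) _ _).fun_comp
      (f := fun x : (Fin p → ℂ) × (Fin p → ℂ) × ℂ => (x.1, x.2.1, x.2.2 + 2)) <|
        analyticAt_fst.prod <| (analyticAt_fst.comp analyticAt_snd).prod <|
          (analyticAt_snd.comp analyticAt_snd).add analyticAt_const
  den_analytic := fun w hw => (C.den_analytic _ (add_two_mem_region.2 hw)).fun_comp
    (f := fun w : (Fin p → ℂ) × ℂ => (w.1, w.2 + 2)) <|
      analyticAt_fst.prod (analyticAt_snd.add analyticAt_const)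
  agree := by
    obtain ⟨B, hB, hagree⟩ := C.agree
    refine ⟨B + 2, by positivity, fun θ hθ m hm ν D hν hhi hD => ?_⟩
    have add_two_re : (D + 2).re = D.re + 2 := by simp
    exact C.lowerNum_eq_den_mul_schwinger hB (hagree θ hθ) hm
      (fun j => ⟨(hν j).1, by linarith [(hν j).2]⟩) (by linarith) (by linarith)

theorem RegularAt.mem_region {C : Γ.Continuation s} {ν : Fin p → ℂ} {D : ℂ}
    (hC : C.RegularAt ν D) : (ν, D) ∈ region C.lo C.hi :=
  ⟨hC.1, hC.2.1⟩

theorem RegularAt.lower {C : Γ.Continuation s} {ν : Fin p → ℂ} {D : ℂ} (hC : C.RegularAt ν D) :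
    C.lower.RegularAt ν (D - 2) :=
  ⟨hC.1, by simpa [Continuation.lower] using hC.2.1,
    by simpa [Continuation.lower] using hC.2.2⟩

end Continuation

variable {m ν : Fin p → ℂ} {D : ℂ}

theorem continued_eq {C : Γ.Continuation s} (hC : C.RegularAt ν D)
    (hm : m ∈ Γ.schwingerMasses s) :
    Γ.continued s m ν D = C.num (m, ν, D) / C.den (ν, D) := by
  have hreg : Γ.IsRegular s ν D := ⟨C, hC⟩
  have hchoose := hreg.choose_spec
  rw [continued, dif_pos hreg, div_eq_div_iff hchoose.2.2 hC.2.2]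
  exact hreg.choose.num_mul_den C hm hchoose.mem_region hC.mem_region

theorem continued_eventuallyEq {C : Γ.Continuation s} (hC : C.RegularAt ν D)
    (hm : m ∈ Γ.schwingerMasses s) :
    (fun m => Γ.continued s m ν D) =ᶠ[𝓝 m] fun m => (C.den (ν, D))⁻¹ * C.num (m, ν, D) := by
  filter_upwards [Γ.isOpen_schwingerMasses.mem_nhds hm] with m' hm'
  rw [continued_eq hC hm', div_eq_inv_mul]

theorem IsRegular.sub_two (hreg : Γ.IsRegular s ν D) : Γ.IsRegular s ν (D - 2) :=
  hreg.imp' Continuation.lower fun _ hC => hC.lower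

theorem analyticAt_continued (hreg : Γ.IsRegular s ν D) (hm : m ∈ Γ.schwingerMasses s) :
    AnalyticAt ℂ (fun m => Γ.continued s m ν D) m := by
  obtain ⟨C, hC⟩ := hreg
  refine AnalyticAt.congr ?_ (continued_eventuallyEq hC hm).symm
  exact analyticAt_const.mul <| (C.num_analytic (m, ν, D) ⟨hm, hC.mem_region⟩).fun_comp
    (f := fun m => (m, ν, D)) (by fun_prop)

theorem continued_sub_two (hreg : Γ.IsRegular s ν D) (hm : m ∈ Γ.schwingerMasses s) :
    Γ.continued s m ν (D - 2) = (-1) ^ L *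
      polyDeriv ℂ (fun j => Pi.single j 1) Γ.symanzikU (fun m => Γ.continued s m ν D) m := by
  obtain ⟨C, hC⟩ := hreg
  rw [polyDeriv_congr _ _ (continued_eventuallyEq hC hm), polyDeriv_const_mul,
    continued_eq hC.lower hm]
  simp only [Continuation.lower, Continuation.lowerNum_mk, sub_add_cancel]
  ring

end Family

section FeynmanPrescription

variable {p : ℕ}

/-- The complex squared masses with negative imaginary parts, on which the Feynman prescription
evaluates the integral. -/
def lowerMasses (p : ℕ) : Set (Fin p → ℂ) :=
  {z | ∀ j, (z j).im < 0}

/-- The boundary value of `f` at real squared masses, approached as `m_j² - i0`. -/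
def boundaryValue (f : (Fin p → ℂ) → ℂ) (x : Fin p → ℝ) : ℂ :=
  limUnder (𝓝[>] (0 : ℝ)) fun η => f (Family.shifted x η)

theorem isOpen_lowerMasses : IsOpen (lowerMasses p) := by
  rw [lowerMasses, Set.ofPred_forall]
  exact isOpen_iInter_of_finite fun j => isOpen_lt (by fun_prop) continuous_const

theorem tendsto_shifted (x : Fin p → ℝ) :
    Tendsto (Family.shifted x) (𝓝[>] 0) (𝓝[lowerMasses p] fun j => (x j : ℂ)) := by
  refine tendsto_nhdsWithin_iff.2 ⟨?_, ?_⟩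
  · refine (Continuous.tendsto' ?_ _ _ ?_).mono_left nhdsWithin_le_nhds
    · exact continuous_pi fun j => by unfold Family.shifted; fun_prop
    · funext j
      simp [Family.shifted]
  · filter_upwards [self_mem_nhdsWithin] with η (hη : 0 < η)
    simpa [lowerMasses, Family.shifted] using fun _ => hη

variable {f g : (Fin p → ℂ) → ℂ} {x : Fin p → ℝ}

theorem eventually_tendsto_shifted (hg : AnalyticAt ℂ g fun j => (x j : ℂ))
    (hfg : f =ᶠ[𝓝[lowerMasses p] fun j => (x j : ℂ)] g) :
    ∀ᶠ y : Fin p → ℝ in 𝓝 x, Tendsto (fun η => f (Family.shifted y η)) (𝓝[>] 0)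
      (𝓝 (g fun j => (y j : ℂ))) := by
  have near_x : ∀ᶠ z in 𝓝 fun j => (x j : ℂ), f =ᶠ[𝓝[lowerMasses p] z] g ∧ AnalyticAt ℂ g z :=
    (eventually_nhds_nhdsWithin.2 hfg).and hg.eventually_analyticAt
  have ofReal_tendsto : Tendsto (fun (y : Fin p → ℝ) j => (y j : ℂ)) (𝓝 x)
      (𝓝 fun j => (x j : ℂ)) := Continuous.tendsto (by fun_prop) x
  filter_upwards [ofReal_tendsto.eventually near_x] with y ⟨hfgy, hgy⟩
  refine (hgy.continuousAt.tendsto.comp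
    ((tendsto_shifted y).mono_right nhdsWithin_le_nhds)).congr' ?_
  exact ((tendsto_shifted y).eventually hfgy).mono fun η hη => hη.symm

theorem boundaryValue_eventuallyEq (hg : AnalyticAt ℂ g fun j => (x j : ℂ))
    (hfg : f =ᶠ[𝓝[lowerMasses p] fun j => (x j : ℂ)] g) :
    boundaryValue f =ᶠ[𝓝 x] g ∘ fun y j => (y j : ℂ) :=
  (eventually_tendsto_shifted hg hfg).mono fun _ hy => hy.limUnder_eq

theorem eventually_tendsto_boundaryValue (hg : AnalyticAt ℂ g fun j => (x j : ℂ))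
    (hfg : f =ᶠ[𝓝[lowerMasses p] fun j => (x j : ℂ)] g) :
    ∀ᶠ y : Fin p → ℝ in 𝓝 x, Tendsto (fun η => f (Family.shifted y η)) (𝓝[>] 0)
      (𝓝 (boundaryValue f y)) :=
  (eventually_tendsto_shifted hg hfg).mono fun _ hy => tendsto_nhds_limUnder ⟨_, hy⟩

theorem analyticAt_boundaryValue (hg : AnalyticAt ℂ g fun j => (x j : ℂ))
    (hfg : f =ᶠ[𝓝[lowerMasses p] fun j => (x j : ℂ)] g) :
    AnalyticAt ℝ (boundaryValue f) x := by
  have ofReal_analytic : AnalyticAt ℝ (fun (y : Fin p → ℝ) j => (y j : ℂ)) x :=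
    (ContinuousLinearMap.pi fun j =>
      Complex.ofRealCLM.comp (ContinuousLinearMap.proj (R := ℝ) j)).analyticAt x
  exact ((hg.restrictScalars (𝕜 := ℝ)).comp ofReal_analytic).congr
    (boundaryValue_eventuallyEq hg hfg).symm

theorem diffOp_boundaryValue (hg : AnalyticAt ℂ g fun j => (x j : ℂ))
    (hfg : f =ᶠ[𝓝[lowerMasses p] fun j => (x j : ℂ)] g) (Q : MvPolynomial (Fin p) ℝ) :
    diffOp Q (boundaryValue f) x =
      polyDeriv ℂ (fun j => Pi.single j 1) Q g fun j => (x j : ℂ) := by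
  have ofReal_line (j : Fin p) (y : Fin p → ℝ) (t : ℝ) :
      (fun i => ((y + t • (Pi.single j 1 : Fin p → ℝ)) i : ℂ)) =
        (fun i => (y i : ℂ)) + t • (Pi.single j 1 : Fin p → ℂ) := by
    funext i
    rcases eq_or_ne i j with rfl | hij
    · simp
    · simp [hij]
  rw [diffOp_eq_polyDeriv, polyDeriv_congr _ _ (boundaryValue_eventuallyEq hg hfg),
    polyDeriv_comp ofReal_line, Function.comp_apply, polyDeriv_real_eq_complex hg]

end FeynmanPrescription

namespace Family

variable {p L n : ℕ} {Γ : Family p L n} {s : Matrix (Fin n) (Fin n) ℝ}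

theorem lowerMasses_subset_schwingerMasses : lowerMasses p ⊆ Γ.schwingerMasses s := by
  intro m hm
  obtain ⟨c, hc, hcm⟩ := Pi.exists_forall_pos_add_lt hm
  refine ⟨Real.pi / 2, ⟨by positivity, le_rfl⟩, c, hc, fun α hα => ?_⟩
  have phase : Complex.exp (Complex.I * (Real.pi / 2 : ℝ)) = Complex.I := by
    rw [mul_comm, Complex.ofReal_div, Complex.ofReal_ofNat, Complex.exp_pi_div_two_mul_I]
  have re_massPairing : (massPairing (Real.pi / 2) α m).re = ∑ j, (m j).im * α j := by
    rw [massPairing, phase, Fintype.linearCombination_apply, Complex.re_sum]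
    simp
  rw [Γ.exp_mul_fullF_div_symanzikU hα, phase, ← Complex.ofReal_div, Complex.sub_re,
    Complex.re_mul_ofReal, Complex.I_re, zero_mul, zero_sub, re_massPairing, Finset.mul_sum,
    ← Finset.sum_neg_distrib]
  refine Finset.sum_le_sum fun j _ => ?_
  rw [← neg_mul]
  exact mul_le_mul_of_nonneg_right (by linarith [hcm j]) (hα j).le

variable {ν : Fin p → ℤ} {D₀ : ℤ} {ε : ℂ}

theorem integral_eq_boundaryValue :
    Γ.integral s ν D₀ ε = boundaryValue (Γ.integralC s ν D₀ ε) :=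
  rfl

theorem isRegular_sub_two (hreg : Γ.IsRegular s (fun j => (ν j : ℂ)) (D₀ - 2 * ε)) :
    Γ.IsRegular s (fun j => (ν j : ℂ)) ((D₀ - 2 : ℤ) - 2 * ε) := by
  simpa [sub_right_comm] using hreg.sub_two

theorem analyticAt_integralC (hreg : Γ.IsRegular s (fun j => (ν j : ℂ)) (D₀ - 2 * ε))
    {m : Fin p → ℂ} (hm : m ∈ Γ.schwingerMasses s) : AnalyticAt ℂ (Γ.integralC s ν D₀ ε) m :=
  analyticAt_const.mul (analyticAt_continued hreg hm)

theorem integralC_sub_two (hreg : Γ.IsRegular s (fun j => (ν j : ℂ)) (D₀ - 2 * ε))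
    {m : Fin p → ℂ} (hm : m ∈ Γ.schwingerMasses s) :
    Γ.integralC s ν (D₀ - 2) ε m = (-1) ^ L *
      polyDeriv ℂ (fun j => Pi.single j 1) Γ.symanzikU (Γ.integralC s ν D₀ ε) m := by
  have dimension_shift : ((D₀ - 2 : ℤ) : ℂ) - 2 * ε = D₀ - 2 * ε - 2 := by push_cast; ring
  unfold integralC
  rw [polyDeriv_const_mul, dimension_shift, continued_sub_two hreg hm, mul_left_comm]

theorem genericMasses_of_mem_schwingerMasses
    (hreg : Γ.IsRegular s (fun j => (ν j : ℂ)) (D₀ - 2 * ε)) {m : Fin p → ℝ}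
    (hm : (fun j => (m j : ℂ)) ∈ Γ.schwingerMasses s) : Γ.GenericMasses s ν D₀ ε m :=
  ⟨_, analyticAt_integralC hreg hm, .of_forall fun _ => rfl⟩

theorem integralC_sub_two_eventuallyEq (hreg : Γ.IsRegular s (fun j => (ν j : ℂ)) (D₀ - 2 * ε))
    {g : (Fin p → ℂ) → ℂ} {z : Fin p → ℂ} (hg : Γ.integralC s ν D₀ ε =ᶠ[𝓝[lowerMasses p] z] g) :
    Γ.integralC s ν (D₀ - 2) ε =ᶠ[𝓝[lowerMasses p] z]
      fun z => (-1) ^ L * polyDeriv ℂ (fun j => Pi.single j 1) Γ.symanzikU g z := by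
  filter_upwards [eventually_eventually_nhdsWithin.2 hg, self_mem_nhdsWithin] with y hgy hy
  rw [isOpen_lowerMasses.nhdsWithin_eq hy] at hgy
  rw [integralC_sub_two hreg (lowerMasses_subset_schwingerMasses hy), polyDeriv_congr _ _ hgy]

variable {m : Fin p → ℝ}

theorem GenericMasses.sub_two (hreg : Γ.IsRegular s (fun j => (ν j : ℂ)) (D₀ - 2 * ε))
    (hm : Γ.GenericMasses s ν D₀ ε m) : Γ.GenericMasses s ν (D₀ - 2) ε m := by
  obtain ⟨g, hg, hgI⟩ := hm
  exact ⟨_, analyticAt_const.mul (analyticAt_polyDeriv hg _ _),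
    integralC_sub_two_eventuallyEq hreg hgI⟩

theorem GenericMasses.analyticAt_integral (hm : Γ.GenericMasses s ν D₀ ε m) :
    AnalyticAt ℝ (Γ.integral s ν D₀ ε) m := by
  obtain ⟨g, hg, hgI⟩ := hm
  exact analyticAt_boundaryValue hg hgI

theorem GenericMasses.eventually_tendsto_integral (hm : Γ.GenericMasses s ν D₀ ε m) :
    ∀ᶠ m' in 𝓝 m, Tendsto (fun η : ℝ => Γ.integralC s ν D₀ ε (shifted m' η)) (𝓝[>] 0)
      (𝓝 (Γ.integral s ν D₀ ε m')) := by
  obtain ⟨g, hg, hgI⟩ := hm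
  exact eventually_tendsto_boundaryValue hg hgI

theorem GenericMasses.integral_sub_two
    (hreg : Γ.IsRegular s (fun j => (ν j : ℂ)) (D₀ - 2 * ε)) (hm : Γ.GenericMasses s ν D₀ ε m) :
    Γ.integral s ν (D₀ - 2) ε m =
      (-1) ^ L * diffOp Γ.symanzikU (Γ.integral s ν D₀ ε) m := by
  obtain ⟨g, hg, hgI⟩ := hm
  have analytic : AnalyticAt ℂ
      (fun z => (-1) ^ L * polyDeriv ℂ (fun j => Pi.single j 1) Γ.symanzikU g z)
      fun j => (m j : ℂ) :=
    analyticAt_const.mul (analyticAt_polyDeriv hg _ _)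
  rw [integral_eq_boundaryValue, integral_eq_boundaryValue, diffOp_boundaryValue hg hgI,
    (boundaryValue_eventuallyEq analytic
      (integralC_sub_two_eventuallyEq hreg hgI)).eq_of_nhds, Function.comp_apply]

end Family

end Feynman

end

theorem mainTheorem5_general {p L n : ℕ} (Γ : Feynman.Family p L n)
    (s : Matrix (Fin n) (Fin n) ℝ) (ν : Fin p → ℤ) (D₀ : ℤ) (ε : ℂ)
    (hreg : Γ.IsRegular s (fun j => (ν j : ℂ)) (D₀ - 2 * ε)) :
    Γ.IsRegular s (fun j => (ν j : ℂ)) ((D₀ - 2 : ℤ) - 2 * ε) ∧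
    (∀ m : Fin p → ℝ, (fun j => (m j : ℂ)) ∈ Γ.schwingerMasses s → Γ.GenericMasses s ν D₀ ε m) ∧
    (∀ m : Fin p → ℝ, Γ.GenericMasses s ν D₀ ε m →
      (∀ D ∈ ({D₀, D₀ - 2} : Set ℤ),
        AnalyticAt ℝ (Γ.integral s ν D ε) m ∧
        ∀ᶠ m' in 𝓝 m, Tendsto (fun η : ℝ => Γ.integralC s ν D ε (Feynman.Family.shifted m' η))
          (𝓝[>] 0) (𝓝 (Γ.integral s ν D ε m'))) ∧
      Γ.integral s ν (D₀ - 2) ε m =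
        (-1) ^ L * Feynman.diffOp Γ.symanzikU (Γ.integral s ν D₀ ε) m) := by
  refine ⟨Feynman.Family.isRegular_sub_two hreg,
    fun m => Feynman.Family.genericMasses_of_mem_schwingerMasses hreg,
    fun m hm => ⟨?_, hm.integral_sub_two hreg⟩⟩
  rintro D (rfl | rfl)
  · exact ⟨hm.analyticAt_integral, hm.eventually_tendsto_integral⟩
  · exact ⟨(hm.sub_two hreg).analyticAt_integral, (hm.sub_two hreg).eventually_tendsto_integral⟩

theorem mainTheorem5 {p L n d : ℕ} (Γ : Feynman.Family p L n)
    (P : Fin n → Fin (d + 1) → ℝ) (ν : Fin p → ℤ) (D₀ : ℤ) (ε : ℂ)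
    (hreg : Γ.IsRegular (Feynman.scales P) (fun j => (ν j : ℂ)) (D₀ - 2 * ε)) :
    (Γ.IsRegular (Feynman.scales P) (fun j => (ν j : ℂ)) ((D₀ - 2 : ℤ) - 2 * ε)) ∧
    (∀ m : Fin p → ℝ, (∀ j, 0 < m j) →
      (fun j => (m j : ℂ)) ∈ Γ.schwingerMasses (Feynman.scales P) →
      Γ.GenericMasses (Feynman.scales P) ν D₀ ε m) ∧
    (∀ m : Fin p → ℝ, (∀ j, 0 < m j) → Γ.GenericMasses (Feynman.scales P) ν D₀ ε m →
      (∀ D ∈ ({D₀, D₀ - 2} : Set ℤ),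
        AnalyticAt ℝ (Γ.integral (Feynman.scales P) ν D ε) m ∧
        ∀ᶠ m' in 𝓝 m, Tendsto
          (fun η : ℝ => Γ.integralC (Feynman.scales P) ν D ε (Feynman.Family.shifted m' η))
          (𝓝[>] 0) (𝓝 (Γ.integral (Feynman.scales P) ν D ε m'))) ∧
      Γ.integral (Feynman.scales P) ν (D₀ - 2) ε m =
        (-1) ^ L * Feynman.diffOp Γ.symanzikU (Γ.integral (Feynman.scales P) ν D₀ ε) m) := by
  obtain ⟨regular, generic, shift⟩ := mainTheorem5_general Γ (Feynman.scales P) ν D₀ ε hreg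
  exact ⟨regular, fun m _ => generic m, fun m _ => shift m⟩
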